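/- Let $N\ge 1$, $p\in[2,\infty)$, and let $\Omega\subset\mathbb R^N$ be a non-empty bounded open set. Let $\Omega_1,\dots,\Omega_M$ be non-empty open subsets of $\Omega$ with $\bigcup_{i=1}^M\overline{\Omega_i}=\overline\Omega$ (it is not required that the $\Omega_i$ touch $\partial\Omega$). For $s_1,\dots,s_M\in(0,1)$ put $$s(x)=\sum_{i=1}^M s_i\,\mathbf 1_{\Omega_i}(x),\qquad \bar s=\frac1{|\Omega|}\int_\Omega s\,dx,\qquad G_s=2^{2\bar s-1}\frac{\Gamma(\bar s)}{\Gamma(1-\bar s)},\qquad w(x,y)=G_s\,y^{1-2s(x)}.$$ For $\tau>0$ let $\mathcal C^\tau=\Omega\times(0,\tau)$ and $\partial_L\mathcal C^\tau=\partial\Omega\times[0,\tau]$. Write $\|f\|_{L^p(\mathcal C^\tau,w)}=\big(\int_{\mathcal C^\tau}|f|^p\,w\,dX\big)^{1/p}$. Let $W^{1,p}(\mathcal C^\tau,w)$ be the space of $u\in L^p(\mathcal C^\tau,w)$ having a weak gradient $\nabla u$ with $|\nabla u|\in L^p(\mathcal C^\tau,w)$, normed by $\big(\|u\|^p_{L^p(\mathcal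 C^\tau,w)}+\|\nabla u\|^p_{L^p(\mathcal C^\tau,w)}\big)^{1/p}$. Let $\mathscr H^{1,p}_{0,L}(\mathcal C^\tau,w)$ be the closure in $W^{1,p}(\mathcal C^\tau,w)$ of those of its elements that are restrictions of functions in $C^\infty(\mathbb R^{N+1})$ and whose support in $\overline{\mathcal C^\tau}$ is disjoint from $\partial_L\mathcal C^\tau$. Then for every $\tau>0$ and $\sigma\in(0,1)$ there is a constant $C_P>0$, depending only on $\tau$, $p$, $\sigma$, $\Omega$ and $\Omega_1,\dots,\Omega_M$, such that for all $s_1,\dots,s_M\in(0,1)$ with $s(x)\le\sigma$ for all $x\in\Omega$ (if the $\Omega_i$ are pairwise disjoint, this means $\max_i s_i\le\sigma$), $$\|u\|_{L^p(\mathcal C^\tau,w)}\le C_P\,\|\nabla u\|_{L^p(\mathcal C^\tau,w)}\qquad\text{for all }u\in\mathscr H^{1,p}_{0,L}(\mathcal C^\tau,w).$$ -/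

import Mathlib

open MeasureTheory Set
open scoped ENNReal ContDiff

noncomputable section

/-- Points `X = (x, y)` of `ℝ^N × ℝ = ℝ^(N+1)`, with Lebesgue measure. Its sup-type product norm is
only used for the topology; gradients are measured in `GradVec`. -/
abbrev Pt (N : ℕ) : Type := EuclideanSpace ℝ (Fin N) × ℝ

/-- Values of gradients: `ℝ^N × ℝ` with the Euclidean norm and inner product. -/
abbrev GradVec (N : ℕ) : Type := WithLp 2 (EuclideanSpace ℝ (Fin N) × ℝ)

/-- The truncated cylinder `Ω × (0, τ)`. -/
def truncCyl {N : ℕ} (Ω : Set (EuclideanSpace ℝ (Fin N))) (τ : ℝ) : Set (Pt N) :=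
  Ω ×ˢ Ioo 0 τ

/-- The lateral boundary `∂Ω × [0, τ]` of the truncated cylinder. -/
def lateralBdry {N : ℕ} (Ω : Set (EuclideanSpace ℝ (Fin N))) (τ : ℝ) : Set (Pt N) :=
  frontier Ω ×ˢ Icc 0 τ

/-- The step function `s = ∑ i, s i * 1_{P i}`. -/
def stepOrder {N M : ℕ} (P : Fin M → Set (EuclideanSpace ℝ (Fin N))) (s : Fin M → ℝ)
    (x : EuclideanSpace ℝ (Fin N)) : ℝ :=
  ∑ i, (P i).indicator (fun _ => s i) x

/-- The mean `(1 / |Ω|) * ∫_Ω s`. -/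
def meanOrder {N : ℕ} (Ω : Set (EuclideanSpace ℝ (Fin N)))
    (s : EuclideanSpace ℝ (Fin N) → ℝ) : ℝ :=
  (volume.real Ω)⁻¹ * ∫ x in Ω, s x

/-- The constant `G = 2^(2 a - 1) Γ(a) / Γ(1 - a)`, where `a` is the mean of `s` over `Ω`. -/
def meanG {N : ℕ} (Ω : Set (EuclideanSpace ℝ (Fin N)))
    (s : EuclideanSpace ℝ (Fin N) → ℝ) : ℝ :=
  (2 : ℝ) ^ (2 * meanOrder Ω s - 1) * Real.Gamma (meanOrder Ω s) /
    Real.Gamma (1 - meanOrder Ω s)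

/-- The weight `w(x, y) = G y^(1 - 2 s(x))`, for `y > 0`. -/
def cylWeight {N : ℕ} (Ω : Set (EuclideanSpace ℝ (Fin N)))
    (s : EuclideanSpace ℝ (Fin N) → ℝ) (X : Pt N) : ℝ :=
  meanG Ω s * X.2 ^ (1 - 2 * s X.1)

/-- The measure `ρ dX` on `U`; `L^p(U, ρ)` is `L^p` of this measure. -/
def weightedMeasure {N : ℕ} (U : Set (Pt N)) (ρ : Pt N → ℝ) : Measure (Pt N) :=
  (volume.restrict U).withDensity (fun X => ENNReal.ofReal (ρ X))

/-- `g` is a weak gradient of `u` on the open set `U`. -/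
def HasWeakGradient {N : ℕ} (U : Set (Pt N)) (u : Pt N → ℝ) (g : Pt N → GradVec N) : Prop :=
  LocallyIntegrableOn u U ∧ LocallyIntegrableOn g U ∧
    ∀ φ : Pt N → ℝ, ContDiff ℝ ∞ φ → HasCompactSupport φ → tsupport φ ⊆ U →
      ∀ v : Pt N, ∫ X in U, u X * fderiv ℝ φ X v =
        - ∫ X in U, inner ℝ (g X) (WithLp.toLp 2 v) * φ X

/-- The norm of `L^p(U, ρ)`, as an extended nonnegative real. -/
def wNorm {N : ℕ} {F : Type*} [NormedAddCommGroup F] (p : ℝ) (U : Set (Pt N)) (ρ : Pt N → ℝ)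
    (f : Pt N → F) : ℝ≥0∞ :=
  eLpNorm f (ENNReal.ofReal p) (weightedMeasure U ρ)

/-- `u ∈ W^{1,p}(U, ρ)` with weak gradient `g`. -/
def MemW {N : ℕ} (p : ℝ) (U : Set (Pt N)) (ρ : Pt N → ℝ) (u : Pt N → ℝ)
    (g : Pt N → GradVec N) : Prop :=
  HasWeakGradient U u g ∧ MemLp u (ENNReal.ofReal p) (weightedMeasure U ρ) ∧
    MemLp g (ENNReal.ofReal p) (weightedMeasure U ρ)

/-- The norm `(∫ |u|^p ρ + ∫ |∇u|^p ρ)^(1/p)` of a function `u` with weak gradient `g`. -/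
def sobolevNorm {N : ℕ} (p : ℝ) (U : Set (Pt N)) (ρ : Pt N → ℝ) (u : Pt N → ℝ)
    (g : Pt N → GradVec N) : ℝ≥0∞ :=
  (wNorm p U ρ u ^ p + wNorm p U ρ g ^ p) ^ (1 / p)

/-- Functions smooth up to the boundary of the truncated cylinder (restrictions of smooth functions
on the whole space) whose support, as functions on the closed cylinder, does not meet the lateral
boundary. -/
def IsCylTest {N : ℕ} (Ω : Set (EuclideanSpace ℝ (Fin N))) (τ : ℝ) (φ : Pt N → ℝ) : Prop :=
  ContDiff ℝ ∞ φ ∧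
    Disjoint (closure (closure (truncCyl Ω τ) ∩ Function.support φ)) (lateralBdry Ω τ)

/-- `u` lies in the closure in `W^{1,p}(Ω × (0, τ), ρ)` of the functions of `IsCylTest` that belong
to `W^{1,p}(Ω × (0, τ), ρ)`. -/
def MemH0L {N : ℕ} (p : ℝ) (Ω : Set (EuclideanSpace ℝ (Fin N))) (τ : ℝ) (ρ : Pt N → ℝ)
    (u : Pt N → ℝ) : Prop :=
  ∃ g : Pt N → GradVec N, MemW p (truncCyl Ω τ) ρ u g ∧
    ∀ ε : ℝ≥0∞, 0 < ε → ∃ (φ : Pt N → ℝ) (h : Pt N → GradVec N),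
      IsCylTest Ω τ φ ∧ MemW p (truncCyl Ω τ) ρ φ h ∧
        sobolevNorm p (truncCyl Ω τ) ρ (u - φ) (g - h) < ε

end

/-! Near `y = 0` the weights `y ^ (1 - 2 * s x)` at different `x` are not uniformly comparable, so a
horizontal Poincaré inequality is used only in the upper half `τ / 2 < y < τ`, and lower points are
reached by vertical segments. For a test function, the value at `(x, y)` is the value at some `(x,
z)` with `z` in the upper half, plus an integral of the vertical derivative between them. On that
segment the weight at height `y` is at most `K y = 2 + (y / τ) ^ (1 - 2 * σ)` times the weight at
the running point (`rpow_le_mul_rpow_of_min_le`), and `K` is integrable since `σ < 1`. Averaging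
over `z` leaves the integral over the upper half, where the weight is constant along slices up to a
factor depending only on `τ`; there the function is extended by zero outside `Ω` and shifted out of
the bounded set `Ω`. `IsCylTest.lintegral_weight_le` combines the two directions. The estimates see
the order only through `0 ≤ s ≤ σ`, and the constant `G` cancels, so the bound is uniform in `s`.
`MemH0L.wNorm_le` passes to the closure. -/

/-! ### Increments along segments and the unweighted directional inequality. -/

lemma lintegral_rpow_le_measure_univ_mul {α : Type*} [MeasurableSpace α] {μ : Measure α} {p : ℝ}
    (hp : 1 ≤ p) {f : α → ℝ≥0∞} (hf : AEMeasurable f μ) :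
    (∫⁻ x, f x ∂μ) ^ p ≤ μ univ ^ (p - 1) * ∫⁻ x, f x ^ p ∂μ := by
  have h := eLpNorm'_le_eLpNorm'_mul_rpow_measure_univ (μ := μ) one_pos hp
    hf.aestronglyMeasurable
  have hp0 : 0 < p := by linarith
  have h2 := ENNReal.rpow_le_rpow h hp0.le
  simp only [eLpNorm', enorm_eq_self, ENNReal.rpow_one, one_div, inv_one] at h2
  rw [ENNReal.mul_rpow_of_nonneg _ _ hp0.le, ← ENNReal.rpow_mul, ← ENNReal.rpow_mul,
    inv_mul_cancel₀ hp0.ne', ENNReal.rpow_one, sub_mul, inv_mul_cancel₀ hp0.ne', one_mul,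
    mul_comm] at h2
  exact h2

lemma enorm_sub_rpow_le_lintegral_deriv {p : ℝ} (hp : 1 ≤ p) {f : ℝ → ℝ} (hf : ContDiff ℝ 1 f)
    (a b : ℝ) :
    ‖f b - f a‖ₑ ^ p ≤
      ENNReal.ofReal |b - a| ^ (p - 1) * ∫⁻ t in uIoc a b, ‖deriv f t‖ₑ ^ p := by
  have hc : Continuous (deriv f) := hf.continuous_deriv le_rfl
  have h1 : f b - f a = ∫ t in a..b, deriv f t :=
    (intervalIntegral.integral_deriv_eq_sub
      (fun x _ => (hf.differentiable one_ne_zero).differentiableAt)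
      (hc.intervalIntegrable _ _)).symm
  have h2 : ‖f b - f a‖ₑ = ‖∫ t in uIoc a b, deriv f t‖ₑ := by
    rw [h1]
    exact enorm_eq_iff_norm_eq.2 (intervalIntegral.norm_intervalIntegral_eq _ _ _ _)
  have h3 : ‖f b - f a‖ₑ ≤ ∫⁻ t in uIoc a b, ‖deriv f t‖ₑ :=
    h2 ▸ enorm_integral_le_lintegral_enorm _
  have hp0 : 0 ≤ p := by linarith
  refine (ENNReal.rpow_le_rpow h3 hp0).trans
    ((lintegral_rpow_le_measure_univ_mul hp hc.enorm.aemeasurable).trans_eq ?_)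
  rw [Measure.restrict_apply_univ, Real.volume_uIoc]

lemma ContDiff.deriv_comp_add_smul {E : Type*} [NormedAddCommGroup E] [NormedSpace ℝ E]
    {v : E → ℝ} (hv : ContDiff ℝ 1 v) (x e : E) (t : ℝ) :
    deriv (fun t : ℝ => v (x + t • e)) t = fderiv ℝ v (x + t • e) e := by
  have h1 : HasDerivAt (fun t : ℝ => x + t • e) e t := by
    simpa using ((hasDerivAt_id t).smul_const e).const_add x
  exact (((hv.differentiable one_ne_zero) _).hasFDerivAt.comp_hasDerivAt t h1).deriv

/-- The Poincaré inequality in the direction `e`. -/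
lemma lintegral_enorm_rpow_le_of_eq_zero_of_translate {E : Type*} [NormedAddCommGroup E]
    [NormedSpace ℝ E] [FiniteDimensional ℝ E] [MeasurableSpace E] [BorelSpace E]
    {μ : Measure E} [μ.IsAddHaarMeasure] {p : ℝ} (hp : 1 ≤ p) {v : E → ℝ} (hv : ContDiff ℝ 1 v)
    {e : E} {l : ℝ} (hl : 0 ≤ l) (h0 : ∀ x, v x ≠ 0 → v (x + l • e) = 0) :
    ∫⁻ x, ‖v x‖ₑ ^ p ∂μ ≤ ENNReal.ofReal l ^ p * ∫⁻ x, ‖fderiv ℝ v x e‖ₑ ^ p ∂μ := by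
  have hp0 : 0 < p := by linarith
  have hc : Continuous fun x => ‖fderiv ℝ v x e‖ₑ ^ p :=
    ENNReal.continuous_rpow_const.comp
      (((hv.continuous_fderiv one_ne_zero).clm_apply continuous_const).enorm)
  have hpt : ∀ x, ‖v x‖ₑ ^ p ≤ ENNReal.ofReal l ^ (p - 1) *
      ∫⁻ t in Ioc 0 l, ‖fderiv ℝ v (x + t • e) e‖ₑ ^ p := by
    intro x
    by_cases hx : v x = 0
    · simp [hx, ENNReal.zero_rpow_of_pos hp0]
    -- Since `v` vanishes at `x + l • e`, the increment along the segment is `-v x`.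
    have h := enorm_sub_rpow_le_lintegral_deriv hp
      (f := fun t : ℝ => v (x + t • e)) (by fun_prop) 0 l
    simp only [hv.deriv_comp_add_smul, h0 x hx, zero_smul, add_zero, zero_sub, enorm_neg,
      sub_zero, abs_of_nonneg hl, uIoc_of_le hl] at h
    exact h
  calc ∫⁻ x, ‖v x‖ₑ ^ p ∂μ
      ≤ ∫⁻ x, ENNReal.ofReal l ^ (p - 1) *
        (∫⁻ t in Ioc 0 l, ‖fderiv ℝ v (x + t • e) e‖ₑ ^ p) ∂μ := lintegral_mono hpt
    _ = ENNReal.ofReal l ^ (p - 1) *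
        ∫⁻ x, (∫⁻ t in Ioc 0 l, ‖fderiv ℝ v (x + t • e) e‖ₑ ^ p) ∂μ :=
      lintegral_const_mul' _ _ (by finiteness)
    _ = ENNReal.ofReal l ^ (p - 1) *
        ∫⁻ t in Ioc 0 l, ∫⁻ x, ‖fderiv ℝ v (x + t • e) e‖ₑ ^ p ∂μ := by
      congr 1
      refine lintegral_lintegral_swap (Continuous.aemeasurable ?_)
      exact hc.comp (f := fun q : E × ℝ => q.1 + q.2 • e) (by fun_prop)
    -- Translation invariance makes the inner integral independent of `t`; the remaining
    -- `t`-integral supplies the last factor `l`.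
    _ = ENNReal.ofReal l ^ (p - 1) *
        ∫⁻ t in Ioc 0 l, ∫⁻ x, ‖fderiv ℝ v x e‖ₑ ^ p ∂μ := by
      congr 1
      refine lintegral_congr fun t => ?_
      exact lintegral_add_right_eq_self (fun x => ‖fderiv ℝ v x e‖ₑ ^ p) (t • e)
    _ = _ := by
      rw [setLIntegral_const, Real.volume_Ioc, sub_zero, mul_comm (lintegral _ _), ← mul_assoc]
      congr 1
      conv_lhs => rw [← ENNReal.rpow_one (ENNReal.ofReal l), ← ENNReal.rpow_mul, one_mul]
      rw [← ENNReal.rpow_add_of_nonneg _ _ (by linarith) zero_le_one, sub_add_cancel]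

/-! ### Power weights and the vertical inequality on `(0, τ)`. -/

/-- For `a ≥ 0`, the condition on `t` gives `y ≤ 2 * t`, whence the 2. For `a ≤ 0`, `t < τ` gives
`(y / t) ^ a ≤ (y / τ) ^ a`, and the base is below 1, so the smallest exponent `1 - 2 * σ` is the
worst. -/
lemma rpow_le_mul_rpow_of_min_le {τ σ a y t : ℝ} (hσ : 1 - 2 * σ ≤ a) (ha : a ≤ 1)
    (hy : y ∈ Ioo 0 τ) (ht : t ∈ Ioo 0 τ) (hyt : min y (τ / 2) ≤ t) :
    y ^ a ≤ (2 + (y / τ) ^ (1 - 2 * σ)) * t ^ a := by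
  obtain ⟨hy0, hyτ⟩ := hy
  obtain ⟨ht0, htτ⟩ := ht
  have hτ : 0 < τ := hy0.trans hyτ
  rw [← div_le_iff₀ (by positivity), ← Real.div_rpow hy0.le ht0.le]
  have hyτ0 : 0 < y / τ := by positivity
  rcases le_total 0 a with h | h
  · have h2 : y / t ≤ 2 := by
      rw [div_le_iff₀ ht0]
      rcases min_le_iff.1 hyt with h | h <;> linarith
    calc (y / t) ^ a ≤ 2 ^ a := Real.rpow_le_rpow (by positivity) h2 h
      _ ≤ 2 ^ (1 : ℝ) := Real.rpow_le_rpow_of_exponent_le one_le_two ha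
      _ ≤ _ := by rw [Real.rpow_one]; linarith [Real.rpow_nonneg hyτ0.le (1 - 2 * σ)]
  · calc (y / t) ^ a ≤ (y / τ) ^ a :=
          Real.rpow_le_rpow_of_nonpos hyτ0 (by gcongr) h
      _ ≤ (y / τ) ^ (1 - 2 * σ) :=
          Real.rpow_le_rpow_of_exponent_ge hyτ0 ((div_le_one hτ).2 hyτ.le) hσ
      _ ≤ _ := by linarith

/-- The exponents differ by at most 2, and `1 + τ + 2 / τ` dominates both `y` and `1 / y`. -/
lemma rpow_le_mul_rpow_of_abs_le_one {τ a b y : ℝ} (ha : |a| ≤ 1) (hb : |b| ≤ 1) (hτ : 0 < τ)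
    (hy : y ∈ Ioo (τ / 2) τ) : y ^ a ≤ (1 + τ + 2 / τ) ^ 2 * y ^ b := by
  obtain ⟨hy1, hy2⟩ := hy
  have hy0 : 0 < y := by linarith
  have hc : |a - b| ≤ 2 := (abs_sub a b).trans (by linarith)
  have h2τ : 0 < 2 / τ := by positivity
  rw [← div_le_iff₀ (by positivity), ← Real.rpow_sub hy0]
  rcases le_total 1 y with h | h
  · calc y ^ (a - b) ≤ y ^ (2 : ℝ) :=
          Real.rpow_le_rpow_of_exponent_le h ((le_abs_self _).trans hc)
      _ = y ^ 2 := by norm_cast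
      _ ≤ _ := by gcongr; linarith
  · calc y ^ (a - b) ≤ y ^ (-2 : ℝ) :=
          Real.rpow_le_rpow_of_exponent_ge hy0 h (by linarith [neg_abs_le (a - b)])
      _ = (1 / y) ^ 2 := by
          rw [Real.rpow_neg hy0.le, one_div, inv_pow]; norm_cast
      _ ≤ _ := by
          gcongr
          have : 1 / y ≤ 2 / τ := by rw [div_le_div_iff₀ hy0 hτ]; linarith
          linarith

/-- The finiteness of the final constant rests on this: `σ < 1` means `1 - 2 * σ > -1`. -/
lemma lintegral_two_add_div_rpow_lt_top {τ σ : ℝ} (hσ : σ < 1) (hτ : 0 < τ) :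
    ∫⁻ y in Ioo 0 τ, ENNReal.ofReal (2 + (y / τ) ^ (1 - 2 * σ)) < ⊤ := by
  have h1 : IntegrableOn (fun y : ℝ => y ^ (1 - 2 * σ)) (Ioo 0 τ) := by
    have := intervalIntegral.intervalIntegrable_rpow' (a := 0) (b := τ)
      (show -1 < 1 - 2 * σ by linarith)
    exact ((intervalIntegrable_iff_integrableOn_Ioc_of_le hτ.le).1 this).mono_set
      Ioo_subset_Ioc_self
  have h2 : IntegrableOn (fun y : ℝ => 2 + (y / τ) ^ (1 - 2 * σ)) (Ioo 0 τ) := by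
    refine Integrable.add (integrableOn_const (by simp)) ?_
    refine IntegrableOn.congr_fun (h1.div_const (τ ^ (1 - 2 * σ))) (fun y hy => ?_)
      measurableSet_Ioo
    exact (Real.div_rpow hy.1.le hτ.le _).symm
  refine lt_of_le_of_lt (lintegral_mono fun y => ?_) h2.hasFiniteIntegral
  exact Real.ofReal_le_enorm _

lemma lintegral_weight_mul_rpow_le {p τ : ℝ} (hp : 1 ≤ p) {f : ℝ → ℝ} (hf : ContDiff ℝ 1 f)
    {w K : ℝ → ℝ≥0∞} (hw : Measurable w) (hK : Measurable K)
    (h : ∀ y ∈ Ioo 0 τ, ∀ t ∈ Ioo 0 τ, min y (τ / 2) ≤ t → w y ≤ K y * w t)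
    {z : ℝ} (hz : z ∈ Ioo (τ / 2) τ) :
    ∫⁻ y in Ioo 0 τ, w y * ‖f y‖ₑ ^ p ≤ (∫⁻ y in Ioo 0 τ, K y) * (2 ^ (p - 1) *
      (w z * ‖f z‖ₑ ^ p + ENNReal.ofReal τ ^ (p - 1) *
        ∫⁻ t in Ioo 0 τ, w t * ‖deriv f t‖ₑ ^ p)) := by
  have hτ : 0 < τ := by linarith [hz.1, hz.2]
  have hz0 : z ∈ Ioo 0 τ := ⟨by linarith [hz.1], hz.2⟩
  have hD : Measurable fun t => ‖deriv f t‖ₑ ^ p := by fun_prop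
  -- It now suffices to bound the integrand by `K y` times a quantity free of `y`.
  rw [← lintegral_mul_const _ hK]
  refine setLIntegral_mono (hK.mul_const _) fun y hy => ?_
  have h1 : ‖f y‖ₑ ^ p ≤ 2 ^ (p - 1) * (‖f z‖ₑ ^ p + ENNReal.ofReal τ ^ (p - 1) *
      ∫⁻ t in uIoc z y, ‖deriv f t‖ₑ ^ p) := by
    have h2 : ‖f y‖ₑ ≤ ‖f z‖ₑ + ‖f y - f z‖ₑ := by
      simpa using enorm_add_le (f z) (f y - f z)
    have hp0 : 0 ≤ p - 1 := by linarith
    refine (ENNReal.rpow_le_rpow h2 (by linarith)).trans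
      ((ENNReal.rpow_add_le_mul_rpow_add_rpow _ _ hp).trans ?_)
    gcongr
    refine (enorm_sub_rpow_le_lintegral_deriv hp hf z y).trans ?_
    gcongr
    rw [abs_le]
    constructor <;> linarith [hz0.1, hz0.2, hy.1, hy.2]
  have h2 : w y * ∫⁻ t in uIoc z y, ‖deriv f t‖ₑ ^ p ≤
      K y * ∫⁻ t in Ioo 0 τ, w t * ‖deriv f t‖ₑ ^ p := by
    rw [← lintegral_const_mul _ hD,
      ← lintegral_const_mul (K y) (f := fun t => w t * ‖deriv f t‖ₑ ^ p) (hw.mul hD)]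
    have hsub : uIoc z y ⊆ Ioo 0 τ := fun t ht =>
      ⟨(lt_min hz0.1 hy.1).trans ht.1, ht.2.trans_lt (max_lt hz0.2 hy.2)⟩
    refine (setLIntegral_mono (by fun_prop) fun t ht => ?_).trans (lintegral_mono_set hsub)
    rw [← mul_assoc]
    gcongr
    refine h y hy t (hsub ht) ?_
    -- A point between `z` and `y` lies above `y` or above `z > τ / 2`, so the weight at `y` can be
    -- moved inside the integral.
    have h3 : min z y < t := ht.1
    rcases min_lt_iff.1 h3 with h3 | h3
    · exact (min_le_right _ _).trans (by linarith [hz.1])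
    · exact (min_le_left _ _).trans h3.le
  have h3 : w y ≤ K y * w z := h y hy z hz0 ((min_le_right _ _).trans hz.1.le)
  calc w y * ‖f y‖ₑ ^ p
      ≤ w y * (2 ^ (p - 1) * (‖f z‖ₑ ^ p + ENNReal.ofReal τ ^ (p - 1) *
      ∫⁻ t in uIoc z y, ‖deriv f t‖ₑ ^ p)) := by gcongr
    _ = 2 ^ (p - 1) * (w y * ‖f z‖ₑ ^ p + ENNReal.ofReal τ ^ (p - 1) *
      (w y * ∫⁻ t in uIoc z y, ‖deriv f t‖ₑ ^ p)) := by ring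
    _ ≤ 2 ^ (p - 1) * (K y * w z * ‖f z‖ₑ ^ p + ENNReal.ofReal τ ^ (p - 1) *
      (K y * ∫⁻ t in Ioo 0 τ, w t * ‖deriv f t‖ₑ ^ p)) := by gcongr
    _ = _ := by ring

/-- Integrating over the base point `z` replaces a point value by an integral; `τ / 2` is the length
of the interval of base points. -/
lemma lintegral_weight_mul_rpow_le_upper_half {p τ : ℝ} (hp : 1 ≤ p) {f : ℝ → ℝ}
    (hf : ContDiff ℝ 1 f) {w K : ℝ → ℝ≥0∞} (hw : Measurable w) (hK : Measurable K)
    (h : ∀ y ∈ Ioo 0 τ, ∀ t ∈ Ioo 0 τ, min y (τ / 2) ≤ t → w y ≤ K y * w t) :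
    ENNReal.ofReal (τ / 2) * ∫⁻ y in Ioo 0 τ, w y * ‖f y‖ₑ ^ p ≤
      (∫⁻ y in Ioo 0 τ, K y) * (2 ^ (p - 1) *
      ((∫⁻ z in Ioo (τ / 2) τ, w z * ‖f z‖ₑ ^ p) +
        ENNReal.ofReal τ ^ (p - 1) * ENNReal.ofReal (τ / 2) *
        ∫⁻ t in Ioo 0 τ, w t * ‖deriv f t‖ₑ ^ p)) := by
  have hfc : Measurable f := hf.continuous.measurable
  have hvol : volume (Ioo (τ / 2) τ) = ENNReal.ofReal (τ / 2) := by
    rw [Real.volume_Ioo]; congr 1; ring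
  have h1 := setLIntegral_mono (μ := volume) (s := Ioo (τ / 2) τ) (by fun_prop)
    fun z hz => lintegral_weight_mul_rpow_le hp hf hw hK h (z := z) hz
  rw [setLIntegral_const, hvol, mul_comm, lintegral_const_mul _ (by fun_prop),
    lintegral_const_mul _ (by fun_prop), lintegral_add_right _ (by fun_prop),
    setLIntegral_const, hvol] at h1
  refine h1.trans_eq ?_
  ring

/-! ### Slices of test functions and the weighted inequality for them. -/

section TestFunctions

variable {N : ℕ} {Ω : Set (EuclideanSpace ℝ (Fin N))} {τ : ℝ} {φ : Pt N → ℝ}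

/-- Over a point of `∂Ω` the closed support stays at a positive distance from `(x, y)`. Hence
extension by zero keeps slices smooth, with no regularity of `∂Ω`. -/
lemma IsCylTest.eventually_indicator_eq_zero (hφ : IsCylTest Ω τ φ) {y : ℝ} (hy : y ∈ Ioo 0 τ)
    {x : EuclideanSpace ℝ (Fin N)} (hx : x ∉ Ω) :
    Ω.indicator (fun x => φ (x, y)) =ᶠ[nhds x] fun _ => 0 := by
  by_cases hxc : x ∈ closure Ω
  · have hxf : (x, y) ∈ lateralBdry Ω τ :=
      ⟨⟨hxc, fun h => hx (interior_subset h)⟩, Ioo_subset_Icc_self hy⟩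
    have h1 : ∀ᶠ x' in nhds x,
        (x', y) ∉ closure (closure (truncCyl Ω τ) ∩ Function.support φ) :=
      (Continuous.prodMk_left y).continuousAt.eventually
        (isClosed_closure.isOpen_compl.mem_nhds (disjoint_right.1 hφ.2 hxf))
    filter_upwards [h1] with x' hx'
    by_cases hm : x' ∈ Ω
    · rw [indicator_of_mem hm]
      by_contra h0
      exact hx' (subset_closure ⟨subset_closure ⟨hm, hy⟩, h0⟩)
    · exact indicator_of_notMem hm _
  · filter_upwards [isClosed_closure.isOpen_compl.mem_nhds hxc] with x' hx'
    exact indicator_of_notMem (fun h => hx' (subset_closure h)) _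

lemma IsCylTest.contDiff_indicator (hΩ : IsOpen Ω) (hφ : IsCylTest Ω τ φ) {y : ℝ}
    (hy : y ∈ Ioo 0 τ) : ContDiff ℝ 1 (Ω.indicator (fun x => φ (x, y))) := by
  rw [contDiff_iff_contDiffAt]
  intro x
  by_cases hx : x ∈ Ω
  · have h1 : ContDiff ℝ 1 fun x => φ (x, y) :=
      (hφ.1.of_le (by exact_mod_cast le_top)).comp (contDiff_prodMk_left y)
    exact h1.contDiffAt.congr_of_eventuallyEq
      (Filter.eventually_of_mem (hΩ.mem_nhds hx) fun _ h => indicator_of_mem h _)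
  · exact contDiffAt_const.congr_of_eventuallyEq (hφ.eventually_indicator_eq_zero hy hx)

lemma IsCylTest.fderiv_indicator (hΩ : IsOpen Ω) (hφ : IsCylTest Ω τ φ) {y : ℝ}
    (hy : y ∈ Ioo 0 τ) (x e : EuclideanSpace ℝ (Fin N)) :
    fderiv ℝ (Ω.indicator (fun x => φ (x, y))) x e =
      Ω.indicator (fun x => fderiv ℝ φ (x, y) (e, 0)) x := by
  by_cases hx : x ∈ Ω
  · have h2 : Ω.indicator (fun x => φ (x, y)) =ᶠ[nhds x] fun x => φ (x, y) :=
      Filter.eventually_of_mem (hΩ.mem_nhds hx) fun _ h => indicator_of_mem h _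
    have h3 : HasFDerivAt (fun x => φ (x, y)) _ x :=
      ((hφ.1.differentiable (by simp)) (x, y)).hasFDerivAt.comp x (hasFDerivAt_prodMk_left x y)
    rw [h2.fderiv_eq, indicator_of_mem hx, h3.fderiv]
    rfl
  · rw [(hφ.eventually_indicator_eq_zero hy hx).fderiv_eq, indicator_of_notMem hx]
    simp

lemma lintegral_indicator_enorm_rpow {α : Type*} [MeasurableSpace α] {μ : Measure α} {p : ℝ}
    (hp : 0 < p) {s : Set α} (hs : MeasurableSet s) (f : α → ℝ) :
    ∫⁻ x, ‖s.indicator f x‖ₑ ^ p ∂μ = ∫⁻ x in s, ‖f x‖ₑ ^ p ∂μ := by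
  rw [← lintegral_indicator hs]
  refine lintegral_congr fun x => ?_
  by_cases hx : x ∈ s <;> simp [hx, ENNReal.zero_rpow_of_pos hp]

lemma IsCylTest.lintegral_slice_le (hΩ : IsOpen Ω) (hφ : IsCylTest Ω τ φ) {p : ℝ} (hp : 1 ≤ p)
    {y : ℝ} (hy : y ∈ Ioo 0 τ) {e : EuclideanSpace ℝ (Fin N)} {l : ℝ} (hl : 0 ≤ l)
    (hle : ∀ x ∈ Ω, x + l • e ∉ Ω) :
    ∫⁻ x in Ω, ‖φ (x, y)‖ₑ ^ p ≤
      ENNReal.ofReal l ^ p * ∫⁻ x in Ω, ‖fderiv ℝ φ (x, y) (e, 0)‖ₑ ^ p := by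
  have hp0 : 0 < p := by linarith
  have h := lintegral_enorm_rpow_le_of_eq_zero_of_translate (μ := volume) hp
    (hφ.contDiff_indicator hΩ hy) (e := e) hl
    (fun x hx => indicator_of_notMem (hle x (mem_of_indicator_ne_zero hx)) _)
  simp only [hφ.fderiv_indicator hΩ hy] at h
  rwa [lintegral_indicator_enorm_rpow hp0 hΩ.measurableSet,
    lintegral_indicator_enorm_rpow hp0 hΩ.measurableSet] at h

/-- Freeze the weight at a base point, apply the unweighted inequality, and unfreeze: each exchange
costs one factor `B`. -/
lemma IsCylTest.lintegral_slice_weight_le (hΩ : IsOpen Ω) (hφ : IsCylTest Ω τ φ) {p : ℝ}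
    (hp : 1 ≤ p) {y : ℝ} (hy : y ∈ Ioo 0 τ) {e : EuclideanSpace ℝ (Fin N)} {l : ℝ} (hl : 0 ≤ l)
    (hle : ∀ x ∈ Ω, x + l • e ∉ Ω) {w : EuclideanSpace ℝ (Fin N) → ℝ≥0∞} (hw : Measurable w)
    {B : ℝ≥0∞} (hB : ∀ x ∈ Ω, ∀ x' ∈ Ω, w x ≤ B * w x') :
    ∫⁻ x in Ω, w x * ‖φ (x, y)‖ₑ ^ p ≤
      ENNReal.ofReal l ^ p * B ^ 2 *
        ∫⁻ x in Ω, w x * ‖fderiv ℝ φ (x, y) (e, 0)‖ₑ ^ p := by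
  rcases Ω.eq_empty_or_nonempty with rfl | ⟨x₀, hx₀⟩
  · simp
  have hφm : Continuous φ := hφ.1.continuous
  have hφ' : Continuous (fderiv ℝ φ) := hφ.1.continuous_fderiv (by simp)
  have m1 : Measurable fun x => ‖φ (x, y)‖ₑ ^ p :=
    (Measurable.pow_const (by fun_prop : Continuous fun x => ‖φ (x, y)‖ₑ).measurable p)
  have m2 : Measurable fun x => ‖fderiv ℝ φ (x, y) (e, 0)‖ₑ ^ p :=
    (Measurable.pow_const
      (by fun_prop : Continuous fun x => ‖fderiv ℝ φ (x, y) (e, 0)‖ₑ).measurable p)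
  calc ∫⁻ x in Ω, w x * ‖φ (x, y)‖ₑ ^ p
      ≤ ∫⁻ x in Ω, B * w x₀ * ‖φ (x, y)‖ₑ ^ p :=
        setLIntegral_mono (by fun_prop) fun x hx => by gcongr; exact hB x hx x₀ hx₀
    _ = B * w x₀ * ∫⁻ x in Ω, ‖φ (x, y)‖ₑ ^ p := lintegral_const_mul _ m1
    _ ≤ B * w x₀ * (ENNReal.ofReal l ^ p *
        ∫⁻ x in Ω, ‖fderiv ℝ φ (x, y) (e, 0)‖ₑ ^ p) := by
      gcongr; exact hφ.lintegral_slice_le hΩ hp hy hl hle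
    _ = ENNReal.ofReal l ^ p * B *
        ∫⁻ x in Ω, w x₀ * ‖fderiv ℝ φ (x, y) (e, 0)‖ₑ ^ p := by
      rw [lintegral_const_mul _ m2]; ring
    _ ≤ ENNReal.ofReal l ^ p * B *
        ∫⁻ x in Ω, B * (w x * ‖fderiv ℝ φ (x, y) (e, 0)‖ₑ ^ p) := by
      refine mul_le_mul_right (setLIntegral_mono (by fun_prop) fun x hx => ?_) _
      rw [← mul_assoc]
      gcongr
      exact hB x₀ hx₀ x hx
    _ = _ := by
      rw [lintegral_const_mul B (f := fun x => w x * ‖fderiv ℝ φ (x, y) (e, 0)‖ₑ ^ p) (hw.mul m2)]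
      ring

/-- The weighted Poincaré inequality for test functions. The weight increases by at most the factor
`K` along vertical segments ending in the upper half of the cylinder, and is almost constant along
the slices of this upper half. -/
lemma IsCylTest.lintegral_weight_le (hΩ : IsOpen Ω) (hτ : 0 < τ) (hφ : IsCylTest Ω τ φ) {p : ℝ}
    (hp : 1 ≤ p) {e : EuclideanSpace ℝ (Fin N)} {l : ℝ} (hl : 0 ≤ l)
    (hle : ∀ x ∈ Ω, x + l • e ∉ Ω) {W : Pt N → ℝ≥0∞} (hW : Measurable W)
    {B : ℝ≥0∞} (hB : ∀ y ∈ Ioo (τ / 2) τ, ∀ x ∈ Ω, ∀ x' ∈ Ω, W (x, y) ≤ B * W (x', y))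
    {K : ℝ → ℝ≥0∞} (hK : Measurable K)
    (h : ∀ x ∈ Ω, ∀ y ∈ Ioo 0 τ, ∀ t ∈ Ioo 0 τ, min y (τ / 2) ≤ t → W (x, y) ≤ K y * W (x, t)) :
    ENNReal.ofReal (τ / 2) * ∫⁻ X in truncCyl Ω τ, W X * ‖φ X‖ₑ ^ p ≤
      (∫⁻ y in Ioo 0 τ, K y) * (2 ^ (p - 1) *
      (ENNReal.ofReal l ^ p * B ^ 2 *
          (∫⁻ X in truncCyl Ω τ, W X * ‖fderiv ℝ φ X (e, 0)‖ₑ ^ p) +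
        ENNReal.ofReal τ ^ (p - 1) * ENNReal.ofReal (τ / 2) *
          ∫⁻ X in truncCyl Ω τ, W X * ‖fderiv ℝ φ X (0, 1)‖ₑ ^ p)) := by
  have hφm : Continuous φ := hφ.1.continuous
  have hφ' : Continuous (fderiv ℝ φ) := hφ.1.continuous_fderiv (by simp)
  have m0 : Measurable fun X => W X * ‖φ X‖ₑ ^ p :=
    hW.mul (Measurable.pow_const (by fun_prop : Continuous fun X => ‖φ X‖ₑ).measurable p)
  have m1 : ∀ v : Pt N, Measurable fun X => W X * ‖fderiv ℝ φ X v‖ₑ ^ p := fun v =>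
    hW.mul (Measurable.pow_const
      (by fun_prop : Continuous fun X => ‖fderiv ℝ φ X v‖ₑ).measurable p)
  have hprod : ∀ (s : Set ℝ) {F : Pt N → ℝ≥0∞}, Measurable F →
      ∫⁻ X in Ω ×ˢ s, F X = ∫⁻ x in Ω, ∫⁻ y in s, F (x, y) := fun s F hF => by
    rw [Measure.volume_eq_prod, ← Measure.prod_restrict, lintegral_prod _ hF.aemeasurable]
  have hhor : ∫⁻ X in Ω ×ˢ Ioo (τ / 2) τ, W X * ‖φ X‖ₑ ^ p ≤ ENNReal.ofReal l ^ p * B ^ 2 *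
      (∫⁻ X in truncCyl Ω τ, W X * ‖fderiv ℝ φ X (e, 0)‖ₑ ^ p) := by
    have hsub : Ω ×ˢ Ioo (τ / 2) τ ⊆ truncCyl Ω τ :=
      prod_mono subset_rfl (Ioo_subset_Ioo_left (by positivity))
    -- The gradient integral is first cut down to the upper half, where the slices have comparable
    -- weights.
    refine le_trans ?_ (mul_le_mul_right (lintegral_mono_set hsub) _)
    rw [Measure.volume_eq_prod, ← Measure.prod_restrict, lintegral_prod_symm _ m0.aemeasurable,
      lintegral_prod_symm _ (m1 _).aemeasurable, ← lintegral_const_mul _ (by fun_prop)]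
    refine setLIntegral_mono (by fun_prop) fun y hy => ?_
    exact hφ.lintegral_slice_weight_le hΩ hp ⟨by linarith [hy.1], hy.2⟩ hl hle
      (w := fun x => W (x, y)) (by fun_prop) (hB y hy)
  have hver : ∀ x ∈ Ω, ENNReal.ofReal (τ / 2) * ∫⁻ y in Ioo 0 τ, W (x, y) * ‖φ (x, y)‖ₑ ^ p ≤
      (∫⁻ y in Ioo 0 τ, K y) * (2 ^ (p - 1) *
      ((∫⁻ z in Ioo (τ / 2) τ, W (x, z) * ‖φ (x, z)‖ₑ ^ p) +
        ENNReal.ofReal τ ^ (p - 1) * ENNReal.ofReal (τ / 2) *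
        ∫⁻ t in Ioo 0 τ, W (x, t) * ‖fderiv ℝ φ (x, t) (0, 1)‖ₑ ^ p)) := by
    intro x hx
    have hd : ∀ t, deriv (fun t => φ (x, t)) t = fderiv ℝ φ (x, t) (0, 1) := fun t =>
      (((hφ.1.differentiable (by simp)) (x, t)).hasFDerivAt.comp_hasDerivAt t
        ((hasDerivAt_const t x).prodMk (hasDerivAt_id t))).deriv
    have := lintegral_weight_mul_rpow_le_upper_half hp (f := fun t => φ (x, t))
      ((hφ.1.of_le (by exact_mod_cast le_top)).comp (contDiff_prodMk_right x))
      (w := fun t => W (x, t)) (by fun_prop) hK (h x hx)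
    simpa only [hd] using this
  have hsum := setLIntegral_mono (μ := volume) (by fun_prop) hver
  rw [lintegral_const_mul _ (by fun_prop), lintegral_const_mul _ (by fun_prop),
    lintegral_const_mul _ (by fun_prop), lintegral_add_left (by fun_prop),
    lintegral_const_mul _ (by fun_prop), ← hprod _ m0, ← hprod _ m0, ← hprod _ (m1 _)] at hsum
  refine hsum.trans ?_
  exact mul_le_mul_right (mul_le_mul_right (add_le_add_left hhor _) _) _

end TestFunctions

/-! ### Weak gradients and passage to the closure. -/

section WeakGradient

variable {N : ℕ} {U : Set (Pt N)}

lemma LocallyIntegrableOn.integrable_mul_of_tsupport_subset {a ψ : Pt N → ℝ}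
    (ha : LocallyIntegrableOn a U) (hψ : Continuous ψ) (hc : HasCompactSupport ψ)
    (hs : tsupport ψ ⊆ U) : Integrable (fun X => a X * ψ X) := by
  have h1 : IntegrableOn (fun X => a X * ψ X) (tsupport ψ) :=
    (ha.integrableOn_compact_subset hs hc).mul_continuousOn hψ.continuousOn hc
  refine (integrableOn_iff_integrable_of_support_subset fun X hX => ?_).1 h1
  exact subset_tsupport _ (right_ne_zero_of_mul hX)

lemma setIntegral_mul_eq_integral_of_tsupport_subset {a ψ : Pt N → ℝ} (hs : tsupport ψ ⊆ U) :
    ∫ X in U, a X * ψ X = ∫ X, a X * ψ X :=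
  setIntegral_eq_integral_of_forall_compl_eq_zero fun X hX => by
    rw [image_eq_zero_of_notMem_tsupport fun h => hX (hs h), mul_zero]

lemma ae_eq_of_setIntegral_mul_eq (hU : IsOpen U) {a b : Pt N → ℝ}
    (ha : LocallyIntegrableOn a U) (hb : LocallyIntegrableOn b U)
    (h : ∀ ψ : Pt N → ℝ, ContDiff ℝ ∞ ψ → HasCompactSupport ψ → tsupport ψ ⊆ U →
      ∫ X in U, a X * ψ X = ∫ X in U, b X * ψ X) :
    ∀ᵐ X ∂volume.restrict U, a X = b X := by
  rw [ae_restrict_iff' hU.measurableSet]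
  have := hU.ae_eq_zero_of_integral_contDiff_smul_eq_zero (μ := volume) (ha.sub hb)
    fun ψ hψ hc hs => by
      have h1 := h ψ hψ hc hs
      rw [setIntegral_mul_eq_integral_of_tsupport_subset hs,
        setIntegral_mul_eq_integral_of_tsupport_subset hs] at h1
      rw [← sub_eq_zero, ← integral_sub
        (LocallyIntegrableOn.integrable_mul_of_tsupport_subset ha hψ.continuous hc hs)
        (LocallyIntegrableOn.integrable_mul_of_tsupport_subset hb hψ.continuous hc hs)] at h1
      rw [← h1]
      refine integral_congr_ae (ae_of_all _ fun X => ?_)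
      simp only [Pi.sub_apply, smul_eq_mul]
      ring
  filter_upwards [this] with X hX hXU
  exact sub_eq_zero.1 (hX hXU)

lemma HasWeakGradient.locallyIntegrableOn_inner {u : Pt N → ℝ} {g : Pt N → GradVec N}
    (h : HasWeakGradient U u g) (c : GradVec N) :
    LocallyIntegrableOn (fun X => inner ℝ (g X) c) U := fun x hx => by
  obtain ⟨s, hs, hi⟩ := h.2.1 x hx
  exact ⟨s, hs, hi.inner_const c⟩

/-- Each coordinate is determined by testing. This allows an arbitrary weak gradient in place of the
one hidden in `MemH0L`. -/
lemma HasWeakGradient.ae_eq (hU : IsOpen U) {u : Pt N → ℝ} {g g' : Pt N → GradVec N}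
    (h : HasWeakGradient U u g) (h' : HasWeakGradient U u g') :
    g =ᵐ[volume.restrict U] g' := by
  have key : ∀ c : GradVec N, ∀ᵐ X ∂volume.restrict U, inner ℝ (g X) c = inner ℝ (g' X) c := by
    intro c
    refine ae_eq_of_setIntegral_mul_eq hU (h.locallyIntegrableOn_inner c)
      (h'.locallyIntegrableOn_inner c) fun ψ hψ hc hs => ?_
    exact neg_injective ((h.2.2 ψ hψ hc hs (WithLp.ofLp c)).symm.trans
      (h'.2.2 ψ hψ hc hs (WithLp.ofLp c)))
  let b := stdOrthonormalBasis ℝ (GradVec N)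
  filter_upwards [ae_all_iff.2 fun i => key (b i)] with X hX
  refine InnerProductSpace.ext_inner_right_basis b.toBasis fun i => ?_
  simpa using hX i

lemma HasWeakGradient.ae_inner_eq_fderiv (hU : IsOpen U) {φ : Pt N → ℝ} {h : Pt N → GradVec N}
    (hφ : ContDiff ℝ 1 φ) (hh : HasWeakGradient U φ h) (v : Pt N) :
    ∀ᵐ X ∂volume.restrict U, inner ℝ (h X) (WithLp.toLp 2 v) = fderiv ℝ φ X v := by
  have hd : Continuous fun X => fderiv ℝ φ X v :=
    (hφ.continuous_fderiv one_ne_zero).clm_apply continuous_const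
  refine ae_eq_of_setIntegral_mul_eq hU (hh.locallyIntegrableOn_inner _)
    (hd.locallyIntegrable.locallyIntegrableOn _) fun ψ hψ hc hs => ?_
  refine neg_injective ((hh.2.2 ψ hψ hc hs v).symm.trans ?_)
  have hψ' : Continuous fun X => fderiv ℝ ψ X v :=
    (hψ.continuous_fderiv (by simp)).clm_apply continuous_const
  have hs' : tsupport (fun X => fderiv ℝ ψ X v) ⊆ U :=
    (tsupport_fderiv_apply_subset ℝ v).trans hs
  rw [setIntegral_mul_eq_integral_of_tsupport_subset hs,
    setIntegral_mul_eq_integral_of_tsupport_subset hs']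
  have : (volume : Measure (Pt N)).IsAddHaarMeasure := by
    rw [Measure.volume_eq_prod]; infer_instance
  exact integral_mul_fderiv_eq_neg_fderiv_mul_of_integrable
    ((hd.mul hψ.continuous).integrable_of_hasCompactSupport hc.mul_left)
    ((hφ.continuous.mul hψ').integrable_of_hasCompactSupport
      (hc.fderiv_apply (𝕜 := ℝ) v).mul_left)
    ((hφ.continuous.mul hψ.continuous).integrable_of_hasCompactSupport hc.mul_left)
    (fun X _ => hφ.differentiable one_ne_zero X)
    (fun X _ => hψ.differentiable (by simp) X)

lemma weightedMeasure_absolutelyContinuous (U : Set (Pt N)) (ρ : Pt N → ℝ) :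
    weightedMeasure U ρ ≪ volume.restrict U :=
  withDensity_absolutelyContinuous _ _

lemma wNorm_eq_lintegral {F : Type*} [NormedAddCommGroup F] {p : ℝ} (hp : 0 < p)
    (U : Set (Pt N)) (ρ : Pt N → ℝ) (f : Pt N → F) :
    wNorm p U ρ f = (∫⁻ X, ‖f X‖ₑ ^ p ∂weightedMeasure U ρ) ^ (1 / p) := by
  rw [wNorm, eLpNorm_eq_lintegral_rpow_enorm_toReal (by simpa using hp) (by simp),
    ENNReal.toReal_ofReal hp.le]

lemma wNorm_left_le_sobolevNorm {p : ℝ} (hp : 0 < p) (U : Set (Pt N)) (ρ : Pt N → ℝ)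
    (u : Pt N → ℝ) (g : Pt N → GradVec N) : wNorm p U ρ u ≤ sobolevNorm p U ρ u g := by
  rw [sobolevNorm, one_div, ENNReal.le_rpow_inv_iff hp]
  exact le_self_add

lemma wNorm_right_le_sobolevNorm {p : ℝ} (hp : 0 < p) (U : Set (Pt N)) (ρ : Pt N → ℝ)
    (u : Pt N → ℝ) (g : Pt N → GradVec N) : wNorm p U ρ g ≤ sobolevNorm p U ρ u g := by
  rw [sobolevNorm, one_div, ENNReal.le_rpow_inv_iff hp]
  exact le_add_self

lemma lintegral_weightedMeasure {ρ : Pt N → ℝ} (hρ : Measurable ρ) {f : Pt N → ℝ≥0∞}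
    (hf : Measurable f) :
    ∫⁻ X, f X ∂weightedMeasure U ρ = ∫⁻ X in U, ENNReal.ofReal (ρ X) * f X :=
  lintegral_withDensity_eq_lintegral_mul _ hρ.ennreal_ofReal hf

/-- An inequality between the norms of test functions and of their gradients passes to the
closure. -/
lemma MemH0L.wNorm_le {Ω : Set (EuclideanSpace ℝ (Fin N))} (hΩ : IsOpen Ω) {τ p : ℝ}
    (hp : 1 ≤ p) {ρ : Pt N → ℝ} {c : ℝ≥0∞} (hc : c ≠ ⊤)
    (htest : ∀ (φ : Pt N → ℝ) (h : Pt N → GradVec N), IsCylTest Ω τ φ →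
      HasWeakGradient (truncCyl Ω τ) φ h →
      wNorm p (truncCyl Ω τ) ρ φ ≤ c * wNorm p (truncCyl Ω τ) ρ h)
    {u : Pt N → ℝ} {g : Pt N → GradVec N} (hu : MemH0L p Ω τ ρ u)
    (hg : HasWeakGradient (truncCyl Ω τ) u g) :
    wNorm p (truncCyl Ω τ) ρ u ≤ c * wNorm p (truncCyl Ω τ) ρ g := by
  obtain ⟨g₀, ⟨hg₀, hu₀, hm₀⟩, happ⟩ := hu
  have hp0 : 0 < p := by linarith
  have hp1 : 1 ≤ ENNReal.ofReal p := by simpa using hp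
  have hgg : wNorm p (truncCyl Ω τ) ρ g = wNorm p (truncCyl Ω τ) ρ g₀ :=
    eLpNorm_congr_ae ((weightedMeasure_absolutelyContinuous _ _).ae_eq
      (hg.ae_eq (hΩ.prod isOpen_Ioo) hg₀))
  rw [hgg]
  refine ENNReal.le_of_forall_pos_le_add fun δ hδ _ => ?_
  have hc1 : 1 + c ≠ ⊤ := by finiteness
  -- The approximation error enters once through `u - φ` and `c` times through the gradients.
  obtain ⟨φ, h, hφ, ⟨hφh, hmφ, hmh⟩, hlt⟩ := happ (δ / (1 + c))
    (ENNReal.div_pos (by exact_mod_cast hδ.ne') hc1)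
  have h1 : wNorm p (truncCyl Ω τ) ρ u ≤
      wNorm p (truncCyl Ω τ) ρ (u - φ) + wNorm p (truncCyl Ω τ) ρ φ := by
    have := eLpNorm_add_le (hu₀.1.sub hmφ.1) hmφ.1 hp1
    rwa [sub_add_cancel] at this
  have h2 : wNorm p (truncCyl Ω τ) ρ h ≤
      wNorm p (truncCyl Ω τ) ρ g₀ + wNorm p (truncCyl Ω τ) ρ (g₀ - h) := by
    have := eLpNorm_sub_le hm₀.1 (hm₀.1.sub hmh.1) hp1
    rwa [sub_sub_cancel] at this
  have h3 := (wNorm_left_le_sobolevNorm hp0 _ ρ (u - φ) (g₀ - h)).trans hlt.le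
  have h4 := (wNorm_right_le_sobolevNorm hp0 _ ρ (u - φ) (g₀ - h)).trans hlt.le
  calc wNorm p (truncCyl Ω τ) ρ u
      ≤ δ / (1 + c) + c * (wNorm p (truncCyl Ω τ) ρ g₀ + δ / (1 + c)) := by
        refine h1.trans (add_le_add h3 ((htest φ h hφ hφh).trans ?_))
        gcongr
        exact h2.trans (by gcongr)
    _ = c * wNorm p (truncCyl Ω τ) ρ g₀ + δ / (1 + c) * (1 + c) := by ring
    _ = c * wNorm p (truncCyl Ω τ) ρ g₀ + δ := by
        rw [ENNReal.div_mul_cancel (by simp) hc1]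

lemma HasWeakGradient.lintegral_fderiv_le (hU : IsOpen U) {φ : Pt N → ℝ} {h : Pt N → GradVec N}
    (hφ : ContDiff ℝ 1 φ) (hh : HasWeakGradient U φ h) {v : Pt N}
    (hv : ‖(WithLp.toLp 2 v : GradVec N)‖ ≤ 1) {p : ℝ} (hp : 0 ≤ p) (ρ : Pt N → ℝ) :
    ∫⁻ X, ‖fderiv ℝ φ X v‖ₑ ^ p ∂weightedMeasure U ρ ≤
      ∫⁻ X, ‖h X‖ₑ ^ p ∂weightedMeasure U ρ := by
  refine lintegral_mono_ae ?_
  filter_upwards [(weightedMeasure_absolutelyContinuous U ρ).ae_le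
    (hh.ae_inner_eq_fderiv hU hφ v)] with X hX
  rw [← hX]
  refine ENNReal.rpow_le_rpow (enorm_le_iff_norm_le.2 ?_) hp
  exact (norm_inner_le_norm _ _).trans (mul_le_of_le_one_right (norm_nonneg _) hv)

/-! ### The weight of the theorem, the explicit constant and the conclusion. -/

/-- For `G ≤ 0` the left side truncates to 0, so the normalising constant cancels without any
information on its sign or size. -/
lemma ofReal_mul_le_ofReal_mul_ofReal {G a b k : ℝ} (ha : 0 ≤ a) (hk : 0 ≤ k)
    (h : a ≤ k * b) :
    ENNReal.ofReal (G * a) ≤ ENNReal.ofReal k * ENNReal.ofReal (G * b) := by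
  rcases le_total 0 G with hG | hG
  · rw [← ENNReal.ofReal_mul hk]
    refine ENNReal.ofReal_le_ofReal ?_
    calc G * a ≤ G * (k * b) := by gcongr
      _ = _ := by ring
  · rw [ENNReal.ofReal_of_nonpos (mul_nonpos_of_nonpos_of_nonneg hG ha)]
    exact zero_le

lemma measurable_cylWeight (Ω : Set (EuclideanSpace ℝ (Fin N)))
    {s : EuclideanSpace ℝ (Fin N) → ℝ} (hs : Measurable s) : Measurable (cylWeight Ω s) :=
  (measurable_snd.pow ((hs.comp measurable_fst).const_mul 2 |>.const_sub 1)).const_mul _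

lemma measurable_stepOrder {M : ℕ} {P : Fin M → Set (EuclideanSpace ℝ (Fin N))}
    (hP : ∀ i, MeasurableSet (P i)) (s : Fin M → ℝ) : Measurable (stepOrder P s) :=
  Finset.measurable_fun_sum _ fun i _ => measurable_const.indicator (hP i)

lemma stepOrder_nonneg {M : ℕ} (P : Fin M → Set (EuclideanSpace ℝ (Fin N))) {s : Fin M → ℝ}
    (hs : ∀ i, 0 ≤ s i) (x : EuclideanSpace ℝ (Fin N)) : 0 ≤ stepOrder P s x :=
  Finset.sum_nonneg fun i _ => indicator_nonneg (fun _ _ => hs i) x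

lemma Bornology.IsBounded.exists_add_smul_notMem {E : Type*} [NormedAddCommGroup E]
    [NormedSpace ℝ E] {s : Set E} (hs : Bornology.IsBounded s) {e : E} (he : ‖e‖ = 1) :
    ∃ l : ℝ, 0 ≤ l ∧ ∀ x ∈ s, x + l • e ∉ s := by
  obtain ⟨R, hR, hsR⟩ := hs.exists_pos_norm_le
  -- Points of `s` are at distance at most `2 * R`, so a shift of length `3 * R` leaves `s`.
  refine ⟨3 * R, by positivity, fun x hx hx' => ?_⟩
  have h1 := hsR _ hx
  have h2 := hsR _ hx'
  have h3 : ‖(3 * R) • e‖ = 3 * R := by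
    rw [norm_smul, he, mul_one, Real.norm_of_nonneg (by positivity)]
  have h4 := norm_sub_le (x + (3 * R) • e) x
  rw [add_sub_cancel_left, h3] at h4
  linarith

/-- The constant of the Poincaré inequality between the `p`-th powers of the norms. -/
noncomputable def poincareConst (p σ τ l : ℝ) : ℝ≥0∞ :=
  (ENNReal.ofReal (τ / 2))⁻¹ *
    ((∫⁻ y in Ioo 0 τ, ENNReal.ofReal (2 + (y / τ) ^ (1 - 2 * σ))) * (2 ^ (p - 1) *
      (ENNReal.ofReal l ^ p * ENNReal.ofReal ((1 + τ + 2 / τ) ^ 2) ^ 2 +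
        ENNReal.ofReal τ ^ (p - 1) * ENNReal.ofReal (τ / 2))))

lemma poincareConst_ne_top {p σ τ : ℝ} (hp : 1 ≤ p) (hσ : σ < 1) (hτ : 0 < τ) (l : ℝ) :
    poincareConst p σ τ l ≠ ⊤ := by
  have h1 := (lintegral_two_add_div_rpow_lt_top hσ hτ).ne
  have h2 : (ENNReal.ofReal (τ / 2))⁻¹ ≠ ⊤ := by simpa using hτ
  have h3 : 0 ≤ p - 1 := by linarith
  have h4 : 0 ≤ p := by linarith
  unfold poincareConst
  finiteness

lemma IsCylTest.wNorm_le {Ω : Set (EuclideanSpace ℝ (Fin N))} (hΩ : IsOpen Ω) {τ : ℝ}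
    (hτ : 0 < τ) {p σ l : ℝ} (hp : 1 ≤ p) (hσ : σ ≤ 1) (hl : 0 ≤ l)
    {e : EuclideanSpace ℝ (Fin N)} (he : ‖e‖ = 1) (hle : ∀ x ∈ Ω, x + l • e ∉ Ω)
    {s : EuclideanSpace ℝ (Fin N) → ℝ} (hs : Measurable s) (hs0 : ∀ x ∈ Ω, 0 ≤ s x)
    (hsσ : ∀ x ∈ Ω, s x ≤ σ) {φ : Pt N → ℝ} {h : Pt N → GradVec N} (hφ : IsCylTest Ω τ φ)
    (hh : HasWeakGradient (truncCyl Ω τ) φ h) :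
    wNorm p (truncCyl Ω τ) (cylWeight Ω s) φ ≤
      poincareConst p σ τ l ^ (1 / p) * wNorm p (truncCyl Ω τ) (cylWeight Ω s) h := by
  have hp0 : 0 < p := by linarith
  have hU : IsOpen (truncCyl Ω τ) := hΩ.prod isOpen_Ioo
  have hφ1 : ContDiff ℝ 1 φ := hφ.1.of_le (by exact_mod_cast le_top)
  have hφ' : Continuous (fderiv ℝ φ) := hφ1.continuous_fderiv one_ne_zero
  have hφc : Continuous φ := hφ1.continuous
  have hρ := measurable_cylWeight Ω hs
  have hexp : ∀ x ∈ Ω, |1 - 2 * s x| ≤ 1 := fun x hx => by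
    rw [abs_le]
    constructor <;> linarith [hs0 x hx, hsσ x hx]
  have m0 : Measurable fun X => ‖φ X‖ₑ ^ p :=
    Measurable.pow_const (by fun_prop : Continuous fun X => ‖φ X‖ₑ).measurable p
  have m1 : ∀ v : Pt N, Measurable fun X => ‖fderiv ℝ φ X v‖ₑ ^ p := fun v =>
    Measurable.pow_const (by fun_prop : Continuous fun X => ‖fderiv ℝ φ X v‖ₑ).measurable p
  have hmain := hφ.lintegral_weight_le hΩ hτ hp hl hle
    (W := fun X => ENNReal.ofReal (cylWeight Ω s X)) hρ.ennreal_ofReal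
    (B := ENNReal.ofReal ((1 + τ + 2 / τ) ^ 2))
    (fun y hy x hx x' hx' => ofReal_mul_le_ofReal_mul_ofReal
      (Real.rpow_nonneg (by linarith [hy.1]) _) (by positivity)
      (rpow_le_mul_rpow_of_abs_le_one (hexp x hx) (hexp x' hx') hτ hy))
    (K := fun y => ENNReal.ofReal (2 + (y / τ) ^ (1 - 2 * σ)))
    (by fun_prop)
    (fun x hx y hy t ht hyt => ofReal_mul_le_ofReal_mul_ofReal
      (Real.rpow_nonneg hy.1.le _)
      (add_nonneg two_pos.le (Real.rpow_nonneg (div_nonneg hy.1.le hτ.le) _))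
      (rpow_le_mul_rpow_of_min_le (by linarith [hsσ x hx]) (by linarith [hs0 x hx]) hy ht hyt))
  rw [← lintegral_weightedMeasure hρ m0, ← lintegral_weightedMeasure hρ (m1 _),
    ← lintegral_weightedMeasure hρ (m1 _)] at hmain
  have he1 : ‖(WithLp.toLp 2 ((e, 0) : Pt N) : GradVec N)‖ ≤ 1 := by
    rw [WithLp.prod_norm_eq_of_L2]; simp [he]
  have he2 : ‖(WithLp.toLp 2 ((0, 1) : Pt N) : GradVec N)‖ ≤ 1 := by
    rw [WithLp.prod_norm_eq_of_L2]; simp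
  have hτ2 : ENNReal.ofReal (τ / 2) ≠ 0 := by simpa using hτ
  rw [wNorm_eq_lintegral hp0, wNorm_eq_lintegral hp0,
    ← ENNReal.mul_rpow_of_nonneg _ _ (by positivity)]
  refine ENNReal.rpow_le_rpow ?_ (by positivity)
  rw [poincareConst, mul_assoc, ← ENNReal.mul_le_iff_le_inv hτ2 (by simp)]
  refine hmain.trans ?_
  -- Both directions have norm at most 1, so each directional integral is bounded by that of `h`.
  rw [mul_assoc (lintegral _ _), mul_assoc (2 ^ (p - 1)), add_mul]
  exact mul_le_mul_right (mul_le_mul_right (add_le_add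
    (mul_le_mul_right (hh.lintegral_fderiv_le hU hφ1 he1 hp0.le _) _)
    (mul_le_mul_right (hh.lintegral_fderiv_le hU hφ1 he2 hp0.le _) _)) _) _

end WeakGradient

theorem theorem6p3 (N : ℕ) (hN : 1 ≤ N) (p : ℝ) (hp : 2 ≤ p)
    (Ω : Set (EuclideanSpace ℝ (Fin N))) (hΩ : IsOpen Ω) (hΩb : Bornology.IsBounded Ω)
    (hΩn : Ω.Nonempty)
    (M : ℕ) (P : Fin M → Set (EuclideanSpace ℝ (Fin N)))
    (hPo : ∀ i, IsOpen (P i)) (hPn : ∀ i, (P i).Nonempty) (hPsub : ∀ i, P i ⊆ Ω)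
    (hPcov : (⋃ i, closure (P i)) = closure Ω)
    (σ : ℝ) (hσ : σ ∈ Ioo (0 : ℝ) 1) (τ : ℝ) (hτ : 0 < τ) :
    ∃ C : ℝ, 0 < C ∧
      ∀ s : Fin M → ℝ, (∀ i, s i ∈ Ioo (0 : ℝ) 1) → (∀ x ∈ Ω, stepOrder P s x ≤ σ) →
        ∀ (u : Pt N → ℝ) (g : Pt N → GradVec N),
          MemH0L p Ω τ (cylWeight Ω (stepOrder P s)) u →
          HasWeakGradient (truncCyl Ω τ) u g →
            wNorm p (truncCyl Ω τ) (cylWeight Ω (stepOrder P s)) u ≤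
              ENNReal.ofReal C * wNorm p (truncCyl Ω τ) (cylWeight Ω (stepOrder P s)) g := by
  have hp1 : 1 ≤ p := by linarith
  have he : ‖(EuclideanSpace.single ⟨0, hN⟩ 1 : EuclideanSpace ℝ (Fin N))‖ = 1 := by simp
  -- The shift `l` depends on `Ω` alone and is fixed before `s`.
  obtain ⟨l, hl, hle⟩ := hΩb.exists_add_smul_notMem he
  have hc : poincareConst p σ τ l ^ (1 / p) ≠ ⊤ :=
    ENNReal.rpow_ne_top_of_nonneg (by positivity) (poincareConst_ne_top hp1 hσ.2 hτ l)
  -- Adding 1 makes the positivity of the constant immediate.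
  refine ⟨(poincareConst p σ τ l ^ (1 / p)).toReal + 1, by positivity,
    fun s hs hsσ u g hu hg => ?_⟩
  have h := hu.wNorm_le hΩ hp1 hc (fun φ h hφ hh =>
    hφ.wNorm_le hΩ hτ hp1 hσ.2.le hl he hle (measurable_stepOrder (fun i => (hPo i).measurableSet) s)
      (fun x _ => stepOrder_nonneg P (fun i => (hs i).1.le) x) hsσ hh) hg
  refine h.trans ?_
  gcongr
  exact (ENNReal.le_ofReal_iff_toReal_le hc (by positivity)).2 (by linarith)
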